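/- Let $n\ge 2$, let $M_n$ and $F_n$ be the free monoid and the free group on $S=\{a_1,\dots,a_n\}$, and identify the elements of $F_n$ with reduced words over $S\cup S^{-1}$. For $G\in\{M_n,F_n\}$ and $v\in G\setminus\{e\}$ let $\rho_v\colon G\to\mathbb R$ be the counting function whose value $\rho_v(w)$ is the number of (possibly overlapping) occurrences of the word $v$ as a subword of $w$, and let $\rho_e(w)=|w|$ be the word length. Let $\mathcal C(G)$ be the real span of all $\rho_v$, $v\in G$, and let $\widehat{\mathcal C}(G)$ be the quotient of $\mathcal C(G)$ by the subspace of bounded functions in it. The cyclic counting function $\widehat{\rho_v}\colon G\to\mathbb R$ assigns to $w$ the number of cyclic occurrences of $v$ in $w$ (if $G=M_n$), respectively in the cyclic reduction $w_0$ of $w$ (if $G=F_n$); here a cyclic occurrence of $v=s_1\cdots s_l$ in a word $r_1\cdots r_m$ is an index $j\in\{1,\dots,m\}$ such that $s_i=r_{j+i}$ for $i=1,\dots,l$, the indices of $r$ being read modulo $m$. Then for $G=M_n$ and for $G=F_n$ every $f\in\mathcal C(G)$ is homogenizable, i.e. the limit $\widehat f(g)=\lim_{k\to\infty} f(g^k)/k$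 exists for every $g\in G$, and $[f]\mapsto\widehat f$ is a well-defined linear isomorphism $$\iota_G\colon \widehat{\mathcal C}(G)\longrightarrow \operatorname{span}_{\mathbb R}\{\widehat{\rho_v}\mid v\in G\}.$$ Moreover, in the group case a counting function need not be at bounded distance from its homogenization: there is $v\in F_n$ such that $\rho_v-\lim_{k\to\infty}\rho_v((\,\cdot\,)^k)/k$ is an unbounded function on $F_n$. -/

import Mathlib

open Filter Topology

noncomputable section

namespace CountingFunctions

/-- The number of (possibly overlapping) occurrences of the word `v` in the word `w`: the number of
starting positions `j` (counted from zero) such that `v` can be read in `w` from position `j` on,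
without running past the end of `w`. For the empty word `v` this is the length of `w`. -/
def wordCount {α : Type*} [DecidableEq α] (v w : List α) : ℕ :=
  ((Finset.range w.length).filter fun j => ∀ i < v.length, v[i]? = w[j + i]?).card

/-- The number of cyclic occurrences of the word `v` in the word `w`: the number of starting
positions `j` such that `v` is read when running (possibly several times) along the circle on which
`w` is written, starting from position `j`. -/
def cyclicWordCount {α : Type*} [DecidableEq α] (v w : List α) : ℕ :=
  ((Finset.range w.length).filter fun j =>
    ∀ i < v.length, v[i]? = w[(j + i) % w.length]?).card

/-- The counting function `ρ_v` on the free monoid. -/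
def rhoM {n : ℕ} (v : FreeMonoid (Fin n)) : FreeMonoid (Fin n) → ℝ :=
  fun w => (wordCount v.toList w.toList : ℝ)

/-- The counting function `ρ_v` on the free group, where elements are identified with the reduced
words representing them. -/
def rhoF {n : ℕ} (v : FreeGroup (Fin n)) : FreeGroup (Fin n) → ℝ :=
  fun w => (wordCount v.toWord w.toWord : ℝ)

/-- The cyclic counting function of `v` on the free monoid. -/
def cyclicRhoM {n : ℕ} (v : FreeMonoid (Fin n)) : FreeMonoid (Fin n) → ℝ :=
  fun w => (cyclicWordCount v.toList w.toList : ℝ)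

/-- The cyclic counting function of `v` on the free group: it counts the cyclic occurrences of the
reduced word of `v` in the cyclic reduction of the reduced word of the argument. -/
def cyclicRhoF {n : ℕ} (v : FreeGroup (Fin n)) : FreeGroup (Fin n) → ℝ :=
  fun w => (cyclicWordCount v.toWord (FreeGroup.reduceCyclically w.toWord) : ℝ)

/-- The space of bounded real-valued functions on `X`. -/
def boundedFunctions (X : Type*) : Submodule ℝ (X → ℝ) where
  carrier := {f | ∃ C : ℝ, ∀ x, |f x| ≤ C}
  zero_mem' := ⟨0, fun x => by simp⟩
  add_mem' := by
    rintro f g ⟨C, hC⟩ ⟨D, hD⟩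
    exact ⟨C + D, fun x => (abs_add_le _ _).trans (add_le_add (hC x) (hD x))⟩
  smul_mem' := by
    rintro c f ⟨C, hC⟩
    refine ⟨|c| * C, fun x => ?_⟩
    simp only [Pi.smul_apply, smul_eq_mul, abs_mul]
    exact mul_le_mul_of_nonneg_left (hC x) (abs_nonneg c)

/-- The space `𝒞(M_n)` spanned by the counting functions on the free monoid. -/
def CM (n : ℕ) : Submodule ℝ (FreeMonoid (Fin n) → ℝ) :=
  Submodule.span ℝ (Set.range (rhoM (n := n)))

/-- The space `𝒞(F_n)` spanned by the counting functions on the free group. -/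
def CF (n : ℕ) : Submodule ℝ (FreeGroup (Fin n) → ℝ) :=
  Submodule.span ℝ (Set.range (rhoF (n := n)))

/-- The quotient of `𝒞(M_n)` by its subspace of bounded functions. -/
abbrev CMHat (n : ℕ) : Type :=
  (CM n) ⧸ (boundedFunctions (FreeMonoid (Fin n))).submoduleOf (CM n)

/-- The quotient of `𝒞(F_n)` by its subspace of bounded functions. -/
abbrev CFHat (n : ℕ) : Type :=
  (CF n) ⧸ (boundedFunctions (FreeGroup (Fin n))).submoduleOf (CF n)

/-- The span of the cyclic counting functions on the free monoid. -/
def cyclicCM (n : ℕ) : Submodule ℝ (FreeMonoid (Fin n) → ℝ) :=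
  Submodule.span ℝ (Set.range (cyclicRhoM (n := n)))

/-- The span of the cyclic counting functions on the free group. -/
def cyclicCF (n : ℕ) : Submodule ℝ (FreeGroup (Fin n) → ℝ) :=
  Submodule.span ℝ (Set.range (cyclicRhoF (n := n)))

/-- `f` is homogenizable and `h` is its homogenization: for every `g` the limit of `f (g ^ k) / k`
as `k → ∞` exists and equals `h g`. -/
def IsHomogenization {M : Type*} [Monoid M] (f h : M → ℝ) : Prop :=
  ∀ g : M, Tendsto (fun k : ℕ => f (g ^ k) / (k : ℝ)) atTop (𝓝 (h g))

end CountingFunctions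

end

open Filter Topology

namespace CountingFunctions

/-! ### Linear and cyclic occurrences in words. -/

section Words

variable {α : Type*} [DecidableEq α]

/-! Cyclic counts are exactly multiplicative on powers of a word and differ from ordinary counts by
at most `v.length`. Hence `ρ_v` has the cyclic count as homogenization; in the group, the conjugator
in `g ^ k = u w₀ ^ k u⁻¹` adds an error depending on `g` but not on `k`. Uniqueness of limits gives
linearity, and surjectivity is read off generators. The point is injectivity: vanishing
homogenization must force boundedness. In the monoid `f` is close to its homogenization. In the
group this fails for long conjugators, but for `n ≥ 2` one extra letter `x` makes any reduced word
`w` cyclically reduced, so `f w` is uniformly close to the homogenization at `w x`.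
`exists_homogenization_linearEquiv` covers both cases through such a correction map `τ`. -/

lemma wordCount_le_cyclicWordCount (v w : List α) : wordCount v w ≤ cyclicWordCount v w := by
  refine Finset.card_le_card fun j hj => ?_
  simp only [Finset.mem_filter, Finset.mem_range] at hj ⊢
  refine ⟨hj.1, fun i hi => ?_⟩
  have h := hj.2 i hi
  rw [List.getElem?_eq_getElem hi] at h
  obtain ⟨hlt, -⟩ := List.getElem?_eq_some_iff.1 h.symm
  rw [List.getElem?_eq_getElem hi, h, Nat.mod_eq_of_lt hlt]

/-- An occurrence that wraps around starts among the last `v.length` positions. -/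
lemma cyclicWordCount_le_wordCount_add (v w : List α) :
    cyclicWordCount v w ≤ wordCount v w + v.length := by
  have hsub : ((Finset.range w.length).filter fun j =>
      ∀ i < v.length, v[i]? = w[(j + i) % w.length]?) ⊆
      ((Finset.range w.length).filter fun j => ∀ i < v.length, v[i]? = w[j + i]?) ∪
        Finset.Ico (w.length - v.length) w.length := by
    intro j hj
    simp only [Finset.mem_union, Finset.mem_filter, Finset.mem_range, Finset.mem_Ico] at hj ⊢
    by_cases h : w.length - v.length ≤ j
    · exact Or.inr ⟨h, hj.1⟩
    · refine Or.inl ⟨hj.1, fun i hi => ?_⟩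
      rw [hj.2 i hi, Nat.mod_eq_of_lt (by omega)]
  refine (Finset.card_le_card hsub).trans ((Finset.card_union_le _ _).trans ?_)
  rw [Nat.card_Ico]
  exact Nat.add_le_add le_rfl (by omega)

lemma abs_wordCount_sub_cyclicWordCount_le (v w : List α) :
    |(wordCount v w : ℝ) - cyclicWordCount v w| ≤ v.length := by
  have h₁ : (wordCount v w : ℝ) ≤ cyclicWordCount v w :=
    mod_cast wordCount_le_cyclicWordCount v w
  have h₂ : (cyclicWordCount v w : ℝ) ≤ wordCount v w + v.length :=
    mod_cast cyclicWordCount_le_wordCount_add v w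
  rw [abs_le]
  constructor <;> linarith

lemma wordCount_le_wordCount_append_right (v w u : List α) :
    wordCount v w ≤ wordCount v (w ++ u) := by
  refine Finset.card_le_card fun j hj => ?_
  simp only [Finset.mem_filter, Finset.mem_range, List.length_append] at hj ⊢
  refine ⟨by omega, fun i hi => ?_⟩
  have h := hj.2 i hi
  rw [List.getElem?_eq_getElem hi] at h
  obtain ⟨hlt, -⟩ := List.getElem?_eq_some_iff.1 h.symm
  rw [List.getElem?_eq_getElem hi, h, List.getElem?_append_left hlt]

/-- New occurrences start in `u` or among the last `v.length` positions of `w`. -/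
lemma wordCount_append_right_le (v w u : List α) :
    wordCount v (w ++ u) ≤ wordCount v w + (v.length + u.length) := by
  have hsub : ((Finset.range (w ++ u).length).filter fun j =>
      ∀ i < v.length, v[i]? = (w ++ u)[j + i]?) ⊆
      ((Finset.range w.length).filter fun j => ∀ i < v.length, v[i]? = w[j + i]?) ∪
        Finset.Ico (w.length - v.length) (w.length + u.length) := by
    intro j hj
    simp only [Finset.mem_union, Finset.mem_filter, Finset.mem_range, Finset.mem_Ico,
      List.length_append] at hj ⊢
    by_cases h : w.length - v.length ≤ j
    · exact Or.inr ⟨h, hj.1⟩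
    · refine Or.inl ⟨by omega, fun i hi => ?_⟩
      rw [hj.2 i hi, List.getElem?_append_left (by omega)]
  refine (Finset.card_le_card hsub).trans ((Finset.card_union_le _ _).trans ?_)
  rw [Nat.card_Ico]
  exact Nat.add_le_add le_rfl (by omega)

lemma wordCount_le_wordCount_append_left (v w u : List α) :
    wordCount v w ≤ wordCount v (u ++ w) := by
  refine Finset.card_le_card_of_injOn (u.length + ·) (fun j hj => ?_)
    (fun a _ b _ h => Nat.add_left_cancel h)
  simp only [Finset.coe_filter, Set.mem_ofPred_eq, Finset.mem_range, List.length_append] at hj ⊢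
  refine ⟨by omega, fun i hi => ?_⟩
  rw [hj.2 i hi, List.getElem?_append_right (by omega)]
  congr 1
  omega

lemma wordCount_append_left_le (v w u : List α) :
    wordCount v (u ++ w) ≤ wordCount v w + u.length := by
  have hsub : ((Finset.range (u ++ w).length).filter fun j =>
      ∀ i < v.length, v[i]? = (u ++ w)[j + i]?) ⊆
      (((Finset.range w.length).filter fun j => ∀ i < v.length, v[i]? = w[j + i]?).image
        (u.length + ·)) ∪ Finset.range u.length := by
    intro j hj
    simp only [Finset.mem_union, Finset.mem_filter, Finset.mem_range, Finset.mem_image,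
      List.length_append] at hj ⊢
    by_cases h : j < u.length
    · exact Or.inr h
    · refine Or.inl ⟨j - u.length, ⟨by omega, fun i hi => ?_⟩, by omega⟩
      rw [hj.2 i hi, List.getElem?_append_right (by omega)]
      congr 1
      omega
  refine (Finset.card_le_card hsub).trans ((Finset.card_union_le _ _).trans ?_)
  rw [Finset.card_range]
  exact Nat.add_le_add Finset.card_image_le le_rfl

lemma abs_wordCount_append_append_sub_le (v u w u' : List α) :
    |(wordCount v (u ++ w ++ u') : ℝ) - wordCount v w| ≤ u.length + v.length + u'.length := by
  have h₁ : (wordCount v w : ℝ) ≤ wordCount v (u ++ w) :=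
    mod_cast wordCount_le_wordCount_append_left v w u
  have h₂ : (wordCount v (u ++ w) : ℝ) ≤ wordCount v (u ++ w ++ u') :=
    mod_cast wordCount_le_wordCount_append_right v (u ++ w) u'
  have h₃ : (wordCount v (u ++ w) : ℝ) ≤ wordCount v w + u.length :=
    mod_cast wordCount_append_left_le v w u
  have h₄ : (wordCount v (u ++ w ++ u') : ℝ) ≤
      wordCount v (u ++ w) + (v.length + u'.length) :=
    mod_cast wordCount_append_right_le v (u ++ w) u'
  rw [abs_le]
  constructor <;> linarith

lemma getElem?_flatten_replicate (w : List α) (k i : ℕ) (hi : i < k * w.length) :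
    (List.replicate k w).flatten[i]? = w[i % w.length]? := by
  induction k generalizing i with
  | zero => omega
  | succ k ih =>
    rw [List.replicate_succ, List.flatten_cons]
    rcases lt_or_ge i w.length with h | h
    · rw [List.getElem?_append_left h, Nat.mod_eq_of_lt h]
    · rw [Nat.succ_mul] at hi
      rw [List.getElem?_append_right h, ih _ (by omega), ← Nat.mod_eq_sub_mod h]

/-- Being the start of a cyclic occurrence is a condition on positions with period `w.length`, and
the power runs through `k` periods. -/
lemma cyclicWordCount_flatten_replicate (v w : List α) (k : ℕ) :
    cyclicWordCount v (List.replicate k w).flatten = k * cyclicWordCount v w := by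
  have hlen : (List.replicate k w).flatten.length = k * w.length := by simp
  let p : ℕ → Prop := fun j => ∀ i < v.length, v[i]? = w[(j + i) % w.length]?
  have hcount (k : ℕ) : Nat.count p (k * w.length) = k * Nat.count p w.length := by
    induction k with
    | zero => simp
    | succ k ih =>
      have hp : (fun j => p (k * w.length + j)) = p := by
        funext j
        simp only [p, add_assoc, Nat.mul_add_mod_self_right]
      rw [Nat.succ_mul, Nat.count_add, ih, Nat.succ_mul]
      simp only [hp]
  have hw : cyclicWordCount v w = Nat.count p w.length :=
    (Nat.count_eq_card_filter_range p _).symm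
  rw [hw, ← hcount, Nat.count_eq_card_filter_range, cyclicWordCount, hlen]
  congr 1
  refine Finset.filter_congr fun j hj => ?_
  have hpos : 0 < k * w.length := (Nat.zero_le j).trans_lt (Finset.mem_range.1 hj)
  refine forall₂_congr fun i _ => ?_
  rw [getElem?_flatten_replicate _ _ _ (Nat.mod_lt _ hpos), Nat.mod_mul_left_mod]

lemma tendsto_div_of_abs_sub_mul_le {a : ℕ → ℝ} {c C : ℝ} (h : ∀ k, |a k - k * c| ≤ C) :
    Tendsto (fun k : ℕ => a k / k) atTop (𝓝 c) := by
  rw [tendsto_iff_norm_sub_tendsto_zero]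
  refine squeeze_zero' (Eventually.of_forall fun k => norm_nonneg _) ?_
    (tendsto_const_div_atTop_nhds_zero_nat C)
  filter_upwards [eventually_gt_atTop 0] with k hk
  have hk' : (0 : ℝ) < k := mod_cast hk
  have : a k / k - c = (a k - k * c) / k := by field_simp
  rw [this, Real.norm_eq_abs, abs_div, abs_of_pos hk']
  exact div_le_div_of_nonneg_right (h k) hk'.le

lemma abs_wordCount_flatten_replicate_sub_le (v w : List α) (k : ℕ) :
    |(wordCount v (List.replicate k w).flatten : ℝ) - k * cyclicWordCount v w| ≤ v.length := by
  have h := abs_wordCount_sub_cyclicWordCount_le v (List.replicate k w).flatten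
  rwa [cyclicWordCount_flatten_replicate, Nat.cast_mul] at h

end Words

/-! ### Homogenization on spans, modulo bounded functions. -/

section Homogenization

variable {M : Type*} [Monoid M]

lemma IsHomogenization.unique {f h h' : M → ℝ} (hf : IsHomogenization f h)
    (hf' : IsHomogenization f h') : h = h' :=
  funext fun g => tendsto_nhds_unique (hf g) (hf' g)

lemma IsHomogenization.add {f f' h h' : M → ℝ} (hf : IsHomogenization f h)
    (hf' : IsHomogenization f' h') : IsHomogenization (f + f') (h + h') := fun g => by
  simpa only [Pi.add_apply, add_div] using (hf g).add (hf' g)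

lemma IsHomogenization.smul {f h : M → ℝ} (c : ℝ) (hf : IsHomogenization f h) :
    IsHomogenization (c • f) (c • h) := fun g => by
  simpa only [Pi.smul_apply, smul_eq_mul, mul_div_assoc] using (hf g).const_mul c

lemma isHomogenization_zero_of_mem_boundedFunctions {f : M → ℝ}
    (hf : f ∈ boundedFunctions M) : IsHomogenization f 0 := fun g => by
  obtain ⟨C, hC⟩ := hf
  exact tendsto_div_of_abs_sub_mul_le (C := C) fun k => by simpa using hC (g ^ k)

variable {I : Type*} {ρ σ : I → M → ℝ}

/-- Since `τ` is the same for all `i`, the map `h ↦ h ∘ τ` is linear and the bounded-distance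
condition passes to linear combinations. -/
lemma exists_isHomogenization_of_mem_span (hρ : ∀ i, IsHomogenization (ρ i) (σ i))
    {τ : M → M} (hτ : ∀ i, ∃ C : ℝ, ∀ w, |ρ i w - σ i (τ w)| ≤ C) {f : M → ℝ}
    (hf : f ∈ Submodule.span ℝ (Set.range ρ)) :
    ∃ h ∈ Submodule.span ℝ (Set.range σ),
      IsHomogenization f h ∧ f - h ∘ τ ∈ boundedFunctions M := by
  induction hf using Submodule.span_induction with
  | mem f hf =>
    obtain ⟨i, rfl⟩ := hf
    exact ⟨σ i, Submodule.subset_span ⟨i, rfl⟩, hρ i, hτ i⟩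
  | zero =>
    refine ⟨0, zero_mem _, isHomogenization_zero_of_mem_boundedFunctions (zero_mem _), ?_⟩
    exact ⟨0, fun x => by simp⟩
  | add f f' _ _ ih ih' =>
    obtain ⟨h, hm, hf, hb⟩ := ih
    obtain ⟨h', hm', hf', hb'⟩ := ih'
    refine ⟨h + h', add_mem hm hm', hf.add hf', ?_⟩
    have := add_mem hb hb'
    rwa [sub_add_sub_comm] at this
  | smul c f _ ih =>
    obtain ⟨h, hm, hf, hb⟩ := ih
    refine ⟨c • h, Submodule.smul_mem _ c hm, hf.smul c, ?_⟩
    have := Submodule.smul_mem _ c hb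
    rwa [smul_sub] at this

lemma exists_mem_span_isHomogenization (hρ : ∀ i, IsHomogenization (ρ i) (σ i)) {h : M → ℝ}
    (hh : h ∈ Submodule.span ℝ (Set.range σ)) :
    ∃ f ∈ Submodule.span ℝ (Set.range ρ), IsHomogenization f h := by
  induction hh using Submodule.span_induction with
  | mem h hh =>
    obtain ⟨i, rfl⟩ := hh
    exact ⟨ρ i, Submodule.subset_span ⟨i, rfl⟩, hρ i⟩
  | zero => exact ⟨0, zero_mem _, isHomogenization_zero_of_mem_boundedFunctions (zero_mem _)⟩
  | add h h' _ _ ih ih' =>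
    obtain ⟨f, hm, hf⟩ := ih
    obtain ⟨f', hm', hf'⟩ := ih'
    exact ⟨f + f', add_mem hm hm', hf.add hf'⟩
  | smul c h _ ih =>
    obtain ⟨f, hm, hf⟩ := ih
    exact ⟨c • f, Submodule.smul_mem _ c hm, hf.smul c⟩

/-- If every `ρ i` has homogenization `σ i` and stays at bounded distance from `σ i ∘ τ` for a map
`τ` that does not depend on `i`, then homogenization identifies the span of the `ρ i` modulo
bounded functions with the span of the `σ i`. -/
theorem exists_homogenization_linearEquiv (hρ : ∀ i, IsHomogenization (ρ i) (σ i))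
    {τ : M → M} (hτ : ∀ i, ∃ C : ℝ, ∀ w, |ρ i w - σ i (τ w)| ≤ C) :
    ∃ ι : (Submodule.span ℝ (Set.range ρ) ⧸
        (boundedFunctions M).submoduleOf (Submodule.span ℝ (Set.range ρ))) ≃ₗ[ℝ]
        Submodule.span ℝ (Set.range σ),
      ∀ f : Submodule.span ℝ (Set.range ρ),
        IsHomogenization (f : M → ℝ) (ι (Submodule.Quotient.mk f) : M → ℝ) := by
  choose h hmem hhom hbdd using fun f : Submodule.span ℝ (Set.range ρ) =>
    exists_isHomogenization_of_mem_span hρ hτ f.2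
  let H : Submodule.span ℝ (Set.range ρ) →ₗ[ℝ] Submodule.span ℝ (Set.range σ) :=
    { toFun := fun f => ⟨h f, hmem f⟩
      map_add' := fun f f' => Subtype.ext ((hhom (f + f')).unique ((hhom f).add (hhom f')))
      map_smul' := fun c f => Subtype.ext ((hhom (c • f)).unique ((hhom f).smul c)) }
  have hker : (boundedFunctions M).submoduleOf (Submodule.span ℝ (Set.range ρ)) =
      LinearMap.ker H := by
    ext f
    rw [Submodule.submoduleOf, Submodule.mem_comap, LinearMap.mem_ker]
    constructor
    · intro hf
      exact Subtype.ext ((hhom f).unique (isHomogenization_zero_of_mem_boundedFunctions hf))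
    · intro hf
      -- With zero homogenization, the bounded function `f - h f ∘ τ` is `f` itself.
      have h0 : h f = 0 := congrArg Subtype.val hf
      simpa [h0, Pi.zero_comp] using hbdd f
  have hsurj : Function.Surjective H := by
    rintro ⟨g, hg⟩
    obtain ⟨f, hf, hfg⟩ := exists_mem_span_isHomogenization hρ hg
    exact ⟨⟨f, hf⟩, Subtype.ext ((hhom ⟨f, hf⟩).unique hfg)⟩
  exact ⟨(Submodule.quotEquivOfEq _ _ hker).trans (H.quotKerEquivOfSurjective hsurj),
    fun f => hhom f⟩

end Homogenization

/-! ### The free monoid. -/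

section FreeMonoid

variable {n : ℕ}

lemma toList_pow_eq_flatten_replicate {α : Type*} (w : FreeMonoid α) (k : ℕ) :
    (w ^ k).toList = (List.replicate k w.toList).flatten := by
  induction k with
  | zero => rfl
  | succ k ih => rw [pow_succ', FreeMonoid.toList_mul, ih, List.replicate_succ, List.flatten_cons]

lemma isHomogenization_rhoM (v : FreeMonoid (Fin n)) :
    IsHomogenization (rhoM v) (cyclicRhoM v) := fun g =>
  tendsto_div_of_abs_sub_mul_le (C := v.toList.length) fun k => by
    rw [rhoM, toList_pow_eq_flatten_replicate]
    exact abs_wordCount_flatten_replicate_sub_le _ _ _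

end FreeMonoid

/-! ### The free group. -/

section FreeGroup

variable {n : ℕ}

lemma isHomogenization_rhoF (v : FreeGroup (Fin n)) :
    IsHomogenization (rhoF v) (cyclicRhoF v) := fun g => by
  set u := FreeGroup.reduceCyclically.conjugator g.toWord
  refine tendsto_div_of_abs_sub_mul_le
    (C := u.length + v.toWord.length + u.length + v.toWord.length) fun k => ?_
  -- The reduced form `u w₀ ^ k u⁻¹` of the power is only valid for `k ≠ 0`.
  rcases Nat.eq_zero_or_pos k with rfl | hk
  · simp only [rhoF, pow_zero, FreeGroup.toWord_one, wordCount, List.length_nil,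
      Finset.range_zero, Finset.filter_empty, Finset.card_empty, Nat.cast_zero, zero_mul, sub_zero,
      abs_zero]
    positivity
  · rw [rhoF, FreeGroup.toWord_pow,
      FreeGroup.reduceCyclically.reduce_flatten_replicate FreeGroup.isReduced_toWord,
      if_neg hk.ne', cyclicRhoF]
    have h₁ := abs_wordCount_append_append_sub_le v.toWord u
      (List.replicate k (FreeGroup.reduceCyclically g.toWord)).flatten (FreeGroup.invRev u)
    have h₂ := abs_wordCount_flatten_replicate_sub_le v.toWord
      (FreeGroup.reduceCyclically g.toWord) k
    rw [FreeGroup.invRev_length] at h₁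
    exact (abs_sub_le _ _ _).trans (add_le_add h₁ h₂)

lemma exists_toWord_eq_append_singleton {α : Type*} [DecidableEq α] [Nontrivial α]
    (w : FreeGroup α) :
    ∃ (w' : FreeGroup α) (x : α × Bool), w'.toWord = w.toWord ++ [x] ∧
      FreeGroup.reduceCyclically w'.toWord = w'.toWord := by
  suffices H : ∃ x : α × Bool, FreeGroup.IsReduced (w.toWord ++ [x]) ∧
      FreeGroup.reduceCyclically (w.toWord ++ [x]) = w.toWord ++ [x] by
    obtain ⟨x, hx, hc⟩ := H
    have h : (FreeGroup.mk (w.toWord ++ [x])).toWord = w.toWord ++ [x] := by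
      rw [FreeGroup.toWord_mk, hx.reduce_eq]
    exact ⟨_, x, h, by rw [h, hc]⟩
  have hw : FreeGroup.IsReduced w.toWord := FreeGroup.isReduced_toWord
  generalize w.toWord = L at hw
  cases L with
  | nil =>
    obtain ⟨a⟩ : Nonempty α := inferInstance
    exact ⟨(a, true), by simp [FreeGroup.IsReduced], by simp⟩
  | cons s L =>
    set t := (s :: L).getLast (by simp)
    -- Repeating the last letter `t` keeps the word reduced; if `t` involves the same generator as
    -- the first letter `s`, a different generator serves instead.
    obtain ⟨x, hxs, hxt⟩ : ∃ x : α × Bool, x.1 ≠ s.1 ∧ (t.1 = x.1 → t.2 = x.2) := by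
      by_cases h : t.1 = s.1
      · obtain ⟨c, hc⟩ := exists_ne s.1
        exact ⟨(c, true), hc, fun h' => absurd (h'.symm.trans h) hc⟩
      · exact ⟨t, h, fun _ => rfl⟩
    refine ⟨x, ?_, ?_⟩
    · refine List.isChain_append.2 ⟨hw, List.isChain_singleton x, fun a ha b hb => ?_⟩
      rw [List.getLast?_eq_some_getLast (by simp), Option.mem_some_iff] at ha
      rw [List.head?_cons, Option.mem_some_iff] at hb
      subst hb
      rw [← ha]
      exact hxt
    · rw [List.cons_append, FreeGroup.reduceCyclically.cons_append, if_neg fun h => hxs h.1]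
      rfl

lemma exists_forall_abs_rhoF_sub_cyclicRhoF_le (hn : 2 ≤ n) :
    ∃ τ : FreeGroup (Fin n) → FreeGroup (Fin n), ∀ v, ∃ C : ℝ, ∀ w,
      |rhoF v w - cyclicRhoF v (τ w)| ≤ C := by
  have : Nontrivial (Fin n) := Fin.nontrivial_iff_two_le.2 hn
  choose τ x hτ hc using exists_toWord_eq_append_singleton (α := Fin n)
  -- Appending one letter costs `v.toWord.length + 1`, passing to the cyclic count another
  -- `v.toWord.length`.
  refine ⟨τ, fun v => ⟨v.toWord.length + 1 + v.toWord.length, fun w => ?_⟩⟩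
  have h₁ := abs_wordCount_append_append_sub_le v.toWord [] w.toWord [x w]
  have h₂ := abs_wordCount_sub_cyclicWordCount_le v.toWord (w.toWord ++ [x w])
  rw [abs_sub_comm] at h₁
  rw [rhoF, cyclicRhoF, hc, hτ]
  refine (abs_sub_le _ _ _).trans (add_le_add (h₁.trans ?_) h₂)
  simp

/-- The witnesses are the conjugates `a ^ k * b * a ^ (-k)`: the letter `a` occurs `k` times in
them, but not in their cyclic reduction. -/
lemma rhoF_of_sub_cyclicRhoF_not_mem_boundedFunctions {a b : Fin n} (hab : a ≠ b) :
    rhoF (FreeGroup.of a) - cyclicRhoF (FreeGroup.of a) ∉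
      boundedFunctions (FreeGroup (Fin n)) := by
  rintro ⟨C, hC⟩
  obtain ⟨k, hk⟩ := exists_nat_gt C
  let L : ℕ → List (Fin n × Bool) := fun k =>
    List.replicate k (a, true) ++ [(b, true)] ++ List.replicate k (a, false)
  -- Peeling off one cancelling outer pair drives the induction for the cyclic reduction.
  have hL (k : ℕ) : L (k + 1) = (a, true) :: (L k ++ [(a, false)]) := by
    simp only [L]
    rw [List.replicate_succ, List.replicate_succ' (a := (a, false))]
    simp
  have hred : FreeGroup.IsReduced (L k) := by
    refine List.isChain_append.2 ⟨List.isChain_append.2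
      ⟨List.isChain_replicate_of_rel _ (by simp), List.isChain_singleton _, ?_⟩,
      List.isChain_replicate_of_rel _ (by simp), ?_⟩
    · intro y hy z hz
      obtain rfl := List.eq_of_mem_replicate (List.mem_of_getLast? hy)
      obtain rfl : (b, true) = z := by simpa using hz
      exact fun h => absurd h hab
    · intro y hy z hz
      obtain rfl := List.eq_of_mem_replicate (List.mem_of_head? hz)
      obtain rfl : (b, true) = y := by simpa using hy
      exact fun h => absurd h hab.symm
  have hcyc (k : ℕ) : FreeGroup.reduceCyclically (L k) = [(b, true)] := by
    induction k with
    | zero => simp [L]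
    | succ k ih => rw [hL, FreeGroup.reduceCyclically.cons_append, if_pos (by simp), ih]
  have hword : (FreeGroup.mk (L k)).toWord = L k := by
    rw [FreeGroup.toWord_mk, hred.reduce_eq]
  have hcount : k ≤ wordCount [(a, true)] (L k) := by
    refine le_trans ?_ (wordCount_le_wordCount_append_right _ _ _)
    refine le_trans ?_ (wordCount_le_wordCount_append_right _ _ _)
    rw [wordCount, Finset.filter_true_of_mem]
    · simp
    · intro j hj i hi
      obtain rfl : i = 0 := by simpa using hi
      have hj' : j < k := by simpa using hj
      simp [hj']
  have hzero : cyclicWordCount [(a, true)] [(b, true)] = 0 := by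
    simp [cyclicWordCount, hab]
  have h := hC (FreeGroup.mk (L k))
  rw [Pi.sub_apply, rhoF, cyclicRhoF, hword, hcyc, FreeGroup.toWord_of, hzero, Nat.cast_zero,
    sub_zero] at h
  have h' : (k : ℝ) ≤ wordCount [(a, true)] (L k) := mod_cast hcount
  linarith [le_abs_self (wordCount [(a, true)] (L k) : ℝ)]

end FreeGroup

end CountingFunctions

theorem theoremA6 (n : ℕ) (hn : 2 ≤ n) :
    (∃ ι : CountingFunctions.CMHat n ≃ₗ[ℝ] CountingFunctions.cyclicCM n,
      ∀ f : CountingFunctions.CM n,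
        CountingFunctions.IsHomogenization (f : FreeMonoid (Fin n) → ℝ)
          (ι (Submodule.Quotient.mk f) : FreeMonoid (Fin n) → ℝ)) ∧
    (∃ ι : CountingFunctions.CFHat n ≃ₗ[ℝ] CountingFunctions.cyclicCF n,
      ∀ f : CountingFunctions.CF n,
        CountingFunctions.IsHomogenization (f : FreeGroup (Fin n) → ℝ)
          (ι (Submodule.Quotient.mk f) : FreeGroup (Fin n) → ℝ)) ∧
    (∃ (v : FreeGroup (Fin n)) (h : FreeGroup (Fin n) → ℝ),
      CountingFunctions.IsHomogenization (CountingFunctions.rhoF v) h ∧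
        CountingFunctions.rhoF v - h ∉
          CountingFunctions.boundedFunctions (FreeGroup (Fin n))) := by

  refine ⟨?_, ?_, ?_⟩
  · exact CountingFunctions.exists_homogenization_linearEquiv
      CountingFunctions.isHomogenization_rhoM (τ := id) fun v =>
        ⟨v.toList.length, fun w => CountingFunctions.abs_wordCount_sub_cyclicWordCount_le _ _⟩
  · obtain ⟨τ, hτ⟩ := CountingFunctions.exists_forall_abs_rhoF_sub_cyclicRhoF_le hn
    exact CountingFunctions.exists_homogenization_linearEquiv
      CountingFunctions.isHomogenization_rhoF hτ
  · exact ⟨_, _, CountingFunctions.isHomogenization_rhoF _,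
      CountingFunctions.rhoF_of_sub_cyclicRhoF_not_mem_boundedFunctions
        (a := ⟨0, by omega⟩) (b := ⟨1, by omega⟩) (by simp)⟩
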